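/- For $k\in\mathbb{Z}$ let $Q_k$ be the set of triples $(r,s,t)\in\mathbb{Z}^3$ such that $$2|s|-(k-2)\le t\le k-2-2|r| \quad\text{and}\quad 2|s|-(k-2)\equiv t\equiv k-2-2|r| \pmod 4 .$$ Let $P_k=Q_{k+1}\cup Q_k$, partially ordered so that $(r',s',t')$ covers $(r,s,t)$ if and only if $t'=t+1$ and $|r'-r|+|s'-s|=1$. Let $J(P_k)$ be the (finite) set of order ideals of $P_k$, i.e. of subsets $I\subseteq P_k$ such that $x\in I$ and $y<x$ imply $y\in I$. Let $y_j$ ($j\in\mathbb{Z}$) be either independent variables, or variables that are periodic, $y_{j+m}=y_j$, for some $m\ge 1$ and otherwise independent (for twisted $n$-gons, $m=2n$). In the field of rational functions over $\mathbb{Q}$ in these variables define $F_{j,k}$, for $j\in\mathbb{Z}$ and $k\ge -1$, by $F_{j,-1}=F_{j,0}=1$ and $$F_{j,k+1}=\frac{F_{j-3,k}F_{j+3,k}+\left(\prod_{i=-k}^{k}y_{j+3i}\right)F_{j-1,k}F_{j+1,k}}{F_{j,k-1}}\qquad (k\ge 0).$$ **Theorem.** No $F_{j,k}$ is zero, so the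 recurrence is well defined, and for all $j\in\mathbb{Z}$ and $k\ge -1$ $$F_{j,k}=\sum_{I\in J(P_k)}\ \prod_{(r,s,t)\in I}y_{3r+s+j}.$$ In particular, $F_{j,k}$ is a polynomial in the variables $y_i$ with integer coefficients, and all its nonzero coefficients are positive. -/

import Mathlib

namespace Pentagram

/-- The set `Q_k` of triples `(r, s, t)`. -/
def Q (k : ℤ) : Set (ℤ × ℤ × ℤ) :=
  {p | (2 * |p.2.1| - (k - 2) ≤ p.2.2 ∧ p.2.2 ≤ k - 2 - 2 * |p.1|) ∧
    (2 * |p.2.1| - (k - 2) ≡ p.2.2 [ZMOD 4] ∧ p.2.2 ≡ k - 2 - 2 * |p.1| [ZMOD 4])}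

/-- The underlying set `Q_{k+1} ∪ Q_k` of the poset `P_k`. It is wrapped in a structure so that it
does not inherit the componentwise order of `ℤ × ℤ × ℤ`. -/
@[ext]
structure P (k : ℤ) where
  r : ℤ
  s : ℤ
  t : ℤ
  mem : (r, s, t) ∈ Q (k + 1) ∪ Q k

/-- `Covers p q` says that `q` covers `p`: `t' = t + 1` and `|r' - r| + |s' - s| = 1`. -/
def Covers {k : ℤ} (p q : P k) : Prop :=
  q.t = p.t + 1 ∧ |q.r - p.r| + |q.s - p.s| = 1

theorem t_le_of_reflTransGen {k : ℤ} {p q : P k} (h : Relation.ReflTransGen Covers p q) :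
    p = q ∨ p.t < q.t := by
  induction h with
  | refl => exact Or.inl rfl
  | tail _ hc ih =>
    have := hc.1
    rcases ih with rfl | ih
    · right; omega
    · right; omega

/-- The partial order on `P_k` generated by the covering relation. -/
instance (k : ℤ) : PartialOrder (P k) where
  le p q := Relation.ReflTransGen Covers p q
  le_refl _ := Relation.ReflTransGen.refl
  le_trans _ _ _ h₁ h₂ := h₁.trans h₂
  le_antisymm p q h₁ h₂ := by
    rcases t_le_of_reflTransGen h₁ with h | h
    · exact h
    · rcases t_le_of_reflTransGen h₂ with h' | h'
      · exact h'.symm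
      · omega

theorem le_def {k : ℤ} {p q : P k} : p ≤ q ↔ Relation.ReflTransGen Covers p q := Iff.rfl

theorem t_lt_of_lt {k : ℤ} {p q : P k} (h : p < q) : p.t < q.t :=
  (t_le_of_reflTransGen h.le).resolve_left h.ne

/-- The covering relation of the order is the prescribed one. -/
theorem covBy_iff {k : ℤ} {p q : P k} : p ⋖ q ↔ Covers p q := by
  constructor
  · rintro ⟨hlt, hno⟩
    rcases Relation.ReflTransGen.cases_head (le_def.1 hlt.le) with h | ⟨c, hpc, hcq⟩
    · exact absurd h hlt.ne
    · have hpc' : p < c := by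
        refine lt_of_le_of_ne (le_def.2 (.single hpc)) ?_
        rintro rfl
        have := hpc.1
        omega
      rcases eq_or_lt_of_le (le_def.2 hcq) with rfl | h
      · exact hpc
      · exact absurd h (hno hpc')
  · intro h
    have ht := h.1
    refine ⟨lt_of_le_of_ne (le_def.2 (.single h)) ?_, fun c h₁ h₂ => ?_⟩
    · rintro rfl
      omega
    · have := t_lt_of_lt h₁
      have := t_lt_of_lt h₂
      omega

theorem finite_Q (k : ℤ) : (Q k).Finite := by
  refine (Set.finite_Icc ((-|k|, -|k|, -|k| - 2) : ℤ × ℤ × ℤ) (|k|, |k|, |k| + 2)).subset ?_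
  rintro ⟨r, s, t⟩ ⟨⟨h₁, h₂⟩, -⟩
  simp only [Set.mem_Icc, Prod.mk_le_mk] at *
  have := le_abs_self k
  have := neg_abs_le k
  have := abs_nonneg r
  have := abs_nonneg s
  have := le_abs_self r
  have := neg_abs_le r
  have := le_abs_self s
  have := neg_abs_le s
  omega

instance (k : ℤ) : Finite (P k) := by
  have : Finite ↥(Q (k + 1) ∪ Q k) := ((finite_Q _).union (finite_Q _)).to_subtype
  refine Finite.of_injective
    (fun p : P k => (⟨(p.r, p.s, p.t), p.mem⟩ : ↥(Q (k + 1) ∪ Q k))) ?_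
  intro p q h
  simp only [Subtype.mk.injEq, Prod.mk.injEq] at h
  exact P.ext h.1 h.2.1 h.2.2

noncomputable instance (k : ℤ) : Fintype (P k) := Fintype.ofFinite _

/-- The set `J(P_k)` of order ideals: subsets `I` of `P_k` such that `x ∈ I` and `y < x` imply
`y ∈ I`. -/
def J (k : ℤ) : Set (Set (P k)) :=
  {I | ∀ x ∈ I, ∀ y, y < x → y ∈ I}

noncomputable instance (k : ℤ) : Fintype (J k) := Fintype.ofFinite _

/-- The variable `y_j`, `j ∈ ℤ`, with indices read modulo `m`. For `m = 0` (as `ZMod 0 = ℤ`) the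
variables are independent; for `m = 2 n` they are those attached to twisted `n`-gons. -/
noncomputable def y (m : ℕ) (j : ℤ) : MvPolynomial (ZMod m) ℤ :=
  MvPolynomial.X (j : ZMod m)

open Classical in
/-- The weight `∏_{(r, s, t) ∈ I} y_{3r+s+j}` of a subset `I` of `P_k`. -/
noncomputable def weight (m : ℕ) (j : ℤ) {k : ℤ} (I : Set (P k)) : MvPolynomial (ZMod m) ℤ :=
  ∏ p : P k with p ∈ I, y m (3 * p.r + p.s + j)

/-- The field of rational functions in the variables `y_j` over `ℚ`. -/
abbrev RatFun (m : ℕ) : Type := FractionRing (MvPolynomial (ZMod m) ℤ)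

/-- `FAux m n j` is `F_{j, n-1}`. -/
noncomputable def FAux (m : ℕ) : ℕ → ℤ → RatFun m
  | 0, _ => 1
  | 1, _ => 1
  | k + 2, j =>
    (FAux m (k + 1) (j - 3) * FAux m (k + 1) (j + 3) +
      (∏ i ∈ Finset.Icc (-(k : ℤ)) k, algebraMap _ (RatFun m) (y m (j + 3 * i))) *
        (FAux m (k + 1) (j - 1) * FAux m (k + 1) (j + 1))) / FAux m k j

/-- The rational functions `F_{j,k}` for `k ≥ -1` (for smaller `k` the value is irrelevant). -/
noncomputable def F (m : ℕ) (j k : ℤ) : RatFun m := FAux m (k + 1).toNat j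

theorem F_neg_one (m : ℕ) (j : ℤ) : F m j (-1) = 1 := by simp [F, FAux]

theorem F_zero (m : ℕ) (j : ℤ) : F m j 0 = 1 := by simp [F, FAux]

/-- The recurrence defining `F_{j,k}`. -/
theorem F_rec (m : ℕ) (j k : ℤ) (hk : 0 ≤ k) :
    F m j (k + 1) = (F m (j - 3) k * F m (j + 3) k +
      (∏ i ∈ Finset.Icc (-k) k, algebraMap _ (RatFun m) (y m (j + 3 * i))) *
        (F m (j - 1) k * F m (j + 1) k)) / F m j (k - 1) := by
  obtain ⟨n, rfl⟩ := Int.eq_ofNat_of_zero_le hk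
  have h₁ : ((n : ℤ) + 1 + 1).toNat = n + 2 := by omega
  have h₂ : ((n : ℤ) + 1).toNat = n + 1 := by omega
  have h₃ : ((n : ℤ) - 1 + 1).toNat = n := by omega
  simp only [F, h₁, h₂, h₃, FAux]

end Pentagram

/-!
Replace the single family `y_{3r+s+j}` by a weight `x r s` for each column `(r, s)` of `P_k`, and
let `G k x` be the generating function of the order ideals. The recurrence for `F` then follows
from the octahedron recurrence
`G_{k+1} G_{k-1} = G_k(left) G_k(right) + (∏_{|i| ≤ k} x i 0) G_k(below) G_k(above)`,
where the arguments on the right are translates of the weights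
(`G_recurrence_of_pos`).

The octahedron recurrence is proved by urban renewal. The poset `P_k` has the two layers `Q_{k+1}`
and `Q_k`, and its covering relations only join one layer to the other. Hence, for a fixed trace
`B` of an ideal on `Q_k`, the trace on `Q_{k+1}` is an arbitrary set between `L`, the elements
below some element of `B`, and `U`, the elements all of whose lower covers lie in `B`. Summing
over these sets gives `∏_L x/(1+x) · ∏_U (1+x)` (`sum_ideals_union`). The same applies to
`P_{k-1}`, whose layers are `Q_k` and `Q_{k-1}`; call the bounds `L'` and `U'`. Each `b ∈ B` has
two horizontal and two vertical neighbour columns. Up to vertical translation, `L` and `U'` are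
the union and the intersection of the two horizontal translates of `B`, so by inclusion–exclusion
their columns, counted together, are the horizontal neighbour columns of the elements of `B`. The
vertical ones are likewise the columns of `L'` and `U`, where `U` has in addition the minimal
elements of `P_k` (`prod_lowerPart_mul_prod_upperPart`, `prod_upperPart_mul_prod_lowerPart`).
Therefore `G k x` is an explicit product times `G (k-1) x'`, where `x'` are the mutated weights
(`G_eq_mul_G_mutate`), and the recurrence follows by induction on `k` for all positive weights at
once.

Positive real weights keep all denominators nonzero. The resulting identity of values at all
positive points is an identity of polynomials (`idealPoly_recurrence`), and the ideal generating
functions do not vanish, since their values at positive points are positive. So they satisfy the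
recurrence that defines `F`.
-/

namespace Pentagram

/-! ### The poset `P_k` on bare triples and its ideal generating function -/

/-- The congruences modulo `4` do not depend on the signs of `r` and `s`, so membership in `Q_k` is
a condition without absolute values. -/
theorem mem_Q_iff {k r s t : ℤ} : (r, s, t) ∈ Q k ↔
    2 * s - (k - 2) ≤ t ∧ -2 * s - (k - 2) ≤ t ∧ t ≤ k - 2 - 2 * r ∧ t ≤ k - 2 + 2 * r ∧
      (t + 2 * s + k - 2) % 4 = 0 ∧ (t + 2 * r - k + 2) % 4 = 0 := by
  simp only [Q, Set.mem_ofPred_eq, Int.ModEq]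
  rcases abs_cases r with ⟨h, _⟩ | ⟨h, _⟩ <;> rcases abs_cases s with ⟨h', _⟩ | ⟨h', _⟩ <;>
    rw [h, h'] <;> omega

/-- The finite set `Q_k` as a `Finset`. -/
noncomputable def QF (k : ℤ) : Finset (ℤ × ℤ × ℤ) := (finite_Q k).toFinset

theorem mem_QF_iff {k r s t : ℤ} : (r, s, t) ∈ QF k ↔
    2 * s - (k - 2) ≤ t ∧ -2 * s - (k - 2) ≤ t ∧ t ≤ k - 2 - 2 * r ∧ t ≤ k - 2 + 2 * r ∧
      (t + 2 * s + k - 2) % 4 = 0 ∧ (t + 2 * r - k + 2) % 4 = 0 := by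
  rw [QF, Set.Finite.mem_toFinset, mem_Q_iff]

/-- The covering relation of `P_k`, on bare triples: `Cov p q` says that `q` covers `p`. -/
def Cov (p q : ℤ × ℤ × ℤ) : Prop :=
  q.2.2 = p.2.2 + 1 ∧ |q.1 - p.1| + |q.2.1 - p.2.1| = 1

theorem cov_iff {r s t r' s' t' : ℤ} : Cov (r, s, t) (r', s', t') ↔
    t' = t + 1 ∧ ((r' = r + 1 ∧ s' = s) ∨ (r' = r - 1 ∧ s' = s) ∨
      (r' = r ∧ s' = s + 1) ∨ (r' = r ∧ s' = s - 1)) := by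
  simp only [Cov]
  rcases abs_cases (r' - r) with ⟨h, _⟩ | ⟨h, _⟩ <;>
    rcases abs_cases (s' - s) with ⟨h', _⟩ | ⟨h', _⟩ <;> rw [h, h'] <;> omega

open Classical in
/-- The subsets of `Z` that contain with each element everything in `Z` that it covers. -/
noncomputable def ideals (Z : Finset (ℤ × ℤ × ℤ)) : Finset (Finset (ℤ × ℤ × ℤ)) :=
  {I ∈ Z.powerset | ∀ p ∈ I, ∀ q ∈ Z, Cov q p → q ∈ I}

/-- The generating function of the order ideals of `P_k`, where an element in the column over
`(r, s)` has weight `x r s`. -/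
noncomputable def G {R : Type*} [CommSemiring R] (k : ℤ) (x : ℤ → ℤ → R) : R :=
  ∑ I ∈ ideals (QF (k + 1) ∪ QF k), ∏ p ∈ I, x p.1 p.2.1

/-- It suffices to test the ideal property on the covering relation. -/
theorem mem_J_iff {k : ℤ} {I : Set (P k)} :
    I ∈ J k ↔ ∀ p ∈ I, ∀ q, Covers q p → q ∈ I := by
  constructor
  · intro h p hp q hq
    exact h p hp q (covBy_iff.2 hq).lt
  · intro h p hp q hq
    have hle := le_def.1 hq.le
    clear hq
    induction hle with
    | refl => exact hp
    | tail _ hc ih => exact ih (h _ hp _ hc)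

theorem sum_weight_eq_G (m : ℕ) (j k : ℤ) :
    ∑ I : J k, weight m j (I : Set (P k)) = G k (fun r s => y m (3 * r + s + j)) := by
  classical
  let tri : P k → ℤ × ℤ × ℤ := fun p => (p.r, p.s, p.t)
  have tri_inj : Function.Injective tri := by
    intro p q h
    simp only [tri, Prod.mk.injEq] at h
    exact P.ext h.1 h.2.1 h.2.2
  have tri_mem : ∀ p, tri p ∈ QF (k + 1) ∪ QF k := by
    intro p
    have := p.mem
    simpa [QF, tri] using this
  have tri_surj : ∀ q ∈ QF (k + 1) ∪ QF k, ∃ p, tri p = q := by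
    rintro ⟨r, s, t⟩ h
    exact ⟨⟨r, s, t, by simpa [QF] using h⟩, rfl⟩
  unfold G
  refine Finset.sum_bij (fun I _ => ({p : P k | p ∈ (I : Set (P k))} : Finset (P k)).image tri)
    ?_ ?_ ?_ ?_
  · rintro ⟨I, hI⟩ -
    rw [mem_J_iff] at hI
    simp only [ideals, Finset.mem_filter, Finset.mem_powerset]
    constructor
    · intro q hq
      obtain ⟨p, -, rfl⟩ := Finset.mem_image.1 hq
      exact tri_mem p
    · intro p hp q hq hc
      obtain ⟨p, rfl⟩ : ∃ p', tri p' = p := by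
        obtain ⟨p', -, h⟩ := Finset.mem_image.1 hp
        exact ⟨p', h⟩
      obtain ⟨q, rfl⟩ := tri_surj q hq
      simp only [tri_inj.mem_finset_image, Finset.mem_filter, Finset.mem_univ, true_and] at hp ⊢
      exact hI p hp q hc
  · rintro ⟨I, hI⟩ - ⟨I', hI'⟩ - h
    have := Finset.image_injective tri_inj h
    ext p
    simpa using congrArg (p ∈ ·) this
  · intro T hT
    simp only [ideals, Finset.mem_filter, Finset.mem_powerset] at hT
    refine ⟨⟨{p | tri p ∈ T}, ?_⟩, Finset.mem_univ _, ?_⟩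
    · rw [mem_J_iff]
      intro p hp q hq
      exact hT.2 _ hp _ (tri_mem q) hq
    · ext q
      simp only [Set.mem_ofPred_eq, Finset.mem_image, Finset.mem_filter, Finset.mem_univ, true_and]
      constructor
      · rintro ⟨p, hp, rfl⟩
        exact hp
      · intro hq
        obtain ⟨p, rfl⟩ := tri_surj q (hT.1 hq)
        exact ⟨p, hq, rfl⟩
  · rintro ⟨I, hI⟩ -
    rw [Finset.prod_image tri_inj.injOn]
    simp only [weight, tri]

/-! ### Summation over the ideals of a two-layer poset -/

open Classical in
/-- The elements of `X` covered by an element of `B`: a set with trace `B` on the other layer has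
to contain them to be an ideal. -/
noncomputable def lowerPart (X B : Finset (ℤ × ℤ × ℤ)) : Finset (ℤ × ℤ × ℤ) :=
  {a ∈ X | ∃ b ∈ B, Cov a b}

open Classical in
/-- The elements of `X` all of whose lower covers in `Y` belong to `B`: a set with trace `B`
on `Y` can contain only these elements of `X` if it is an ideal. -/
noncomputable def upperPart (X Y B : Finset (ℤ × ℤ × ℤ)) : Finset (ℤ × ℤ × ℤ) :=
  {a ∈ X | ∀ b ∈ Y, Cov b a → b ∈ B}

theorem mem_lowerPart {X B : Finset (ℤ × ℤ × ℤ)} {a : ℤ × ℤ × ℤ} :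
    a ∈ lowerPart X B ↔ a ∈ X ∧ ∃ b ∈ B, Cov a b := by
  simp only [lowerPart, Finset.mem_filter]

theorem mem_upperPart {X Y B : Finset (ℤ × ℤ × ℤ)} {a : ℤ × ℤ × ℤ} :
    a ∈ upperPart X Y B ↔ a ∈ X ∧ ∀ b ∈ Y, Cov b a → b ∈ B := by
  simp only [upperPart, Finset.mem_filter]

open Classical in
/-- Summation over the ideals of a two-layer poset `X ∪ Y`: for a given trace `B` on `Y`, the trace
on `X` is an arbitrary set between `lowerPart X B` and `upperPart X Y B`. -/
theorem sum_ideals_union {R : Type*} [CommSemiring R] {X Y : Finset (ℤ × ℤ × ℤ)}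
    (hXY : Disjoint X Y) (hX : ∀ a ∈ X, ∀ a' ∈ X, ¬ Cov a a') (hY : ∀ b ∈ Y, ∀ b' ∈ Y, ¬ Cov b b')
    (w : ℤ × ℤ × ℤ → R) :
    ∑ I ∈ ideals (X ∪ Y), ∏ p ∈ I, w p =
      ∑ B ∈ Y.powerset, if lowerPart X B ⊆ upperPart X Y B then
        (∏ b ∈ B, w b) * ((∏ a ∈ lowerPart X B, w a) *
          ∏ a ∈ upperPart X Y B \ lowerPart X B, (1 + w a)) else 0 := by
  have hmaps : ∀ I ∈ ideals (X ∪ Y), I ∩ Y ∈ Y.powerset := fun I _ =>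
    Finset.mem_powerset.2 Finset.inter_subset_right
  rw [← Finset.sum_fiberwise_of_maps_to hmaps]
  refine Finset.sum_congr rfl fun B hB => ?_
  rw [Finset.mem_powerset] at hB
  -- An ideal with trace `B` on `Y` has its trace on `X` between the two bounds.
  have key : ∀ I ∈ ideals (X ∪ Y), I ∩ Y = B →
      lowerPart X B ⊆ I ∩ X ∧ I ∩ X ⊆ upperPart X Y B := by
    intro I hI hIB
    simp only [ideals, Finset.mem_filter, Finset.mem_powerset] at hI
    subst hIB
    constructor
    · intro a ha
      simp only [lowerPart, Finset.mem_filter] at ha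
      obtain ⟨haX, b, hb, hc⟩ := ha
      exact Finset.mem_inter.2 ⟨hI.2 b (Finset.mem_inter.1 hb).1 a
        (Finset.mem_union_left _ haX) hc, haX⟩
    · intro a ha
      rw [Finset.mem_inter] at ha
      simp only [upperPart, Finset.mem_filter]
      exact ⟨ha.2, fun b hb hc => Finset.mem_inter.2
        ⟨hI.2 a ha.1 b (Finset.mem_union_right _ hb) hc, hb⟩⟩
  split_ifs with hLU
  · rw [Finset.prod_one_add, Finset.mul_sum, Finset.mul_sum]
    have hLX : lowerPart X B ⊆ X := Finset.filter_subset _ _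
    have hUX : upperPart X Y B ⊆ X := Finset.filter_subset _ _
    refine Finset.sum_bij' (fun I _ => (I ∩ X) \ lowerPart X B)
      (fun A _ => B ∪ (lowerPart X B ∪ A)) ?_ ?_ ?_ ?_ ?_
    · intro I hI
      rw [Finset.mem_filter] at hI
      exact Finset.mem_powerset.2 (Finset.sdiff_subset_sdiff (key I hI.1 hI.2).2 subset_rfl)
    · intro A hA
      rw [Finset.mem_powerset] at hA
      have hAU : A ⊆ upperPart X Y B := hA.trans Finset.sdiff_subset
      have hLA : lowerPart X B ∪ A ⊆ upperPart X Y B := Finset.union_subset hLU hAU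
      simp only [ideals, Finset.mem_filter, Finset.mem_powerset]
      refine ⟨⟨Finset.union_subset (hB.trans Finset.subset_union_right)
        ((hLA.trans hUX).trans Finset.subset_union_left), ?_⟩, ?_⟩
      · intro p hp q hq hc
        rcases Finset.mem_union.1 hp with hp | hp <;> rcases Finset.mem_union.1 hq with hq | hq
        · exact Finset.mem_union_right _ (Finset.mem_union_left _
            (Finset.mem_filter.2 ⟨hq, p, hp, hc⟩))
        · exact absurd hc (hY q hq p (hB hp))
        · exact absurd hc (hX q hq p (hUX (hLA hp)))
        · exact Finset.mem_union_left _ ((Finset.mem_filter.1 (hLA hp)).2 q hq hc)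
      · rw [Finset.union_inter_distrib_right, Finset.inter_eq_left.2 hB,
          Finset.disjoint_iff_inter_eq_empty.1
            (Finset.disjoint_of_subset_left (hLA.trans hUX) hXY), Finset.union_empty]
    · intro I hI
      rw [Finset.mem_filter] at hI
      have hk := key I hI.1 hI.2
      have hIZ : I ⊆ X ∪ Y := Finset.mem_powerset.1 (Finset.mem_filter.1 hI.1).1
      rw [Finset.union_sdiff_of_subset hk.1, ← hI.2, ← Finset.inter_union_distrib_left,
        Finset.union_comm Y, Finset.inter_eq_left.2 hIZ]
    · intro A hA
      rw [Finset.mem_powerset] at hA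
      have hAX : A ⊆ X := (hA.trans Finset.sdiff_subset).trans hUX
      have hdis : Disjoint A (lowerPart X B) := Finset.disjoint_of_subset_left hA
        Finset.sdiff_disjoint
      rw [Finset.union_inter_distrib_right, Finset.inter_eq_left.2 (Finset.union_subset hLX hAX),
        Finset.inter_comm, Finset.disjoint_iff_inter_eq_empty.1
          (Finset.disjoint_of_subset_right hB hXY), Finset.empty_union,
        Finset.union_sdiff_left, Finset.sdiff_eq_self_of_disjoint hdis]
    · intro I hI
      rw [Finset.mem_filter] at hI
      have hk := key I hI.1 hI.2
      have hIZ : I ⊆ X ∪ Y := Finset.mem_powerset.1 (Finset.mem_filter.1 hI.1).1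
      rw [mul_comm (∏ a ∈ lowerPart X B, w a), Finset.prod_sdiff hk.1, ← hI.2,
        ← Finset.prod_union (Finset.disjoint_of_subset_left Finset.inter_subset_right
          (Finset.disjoint_of_subset_right Finset.inter_subset_right hXY.symm)),
        ← Finset.inter_union_distrib_left, Finset.union_comm Y, Finset.inter_eq_left.2 hIZ]
  · rw [Finset.filter_false_of_mem, Finset.sum_empty]
    intro I hI hIB
    exact hLU ((key I hI hIB).1.trans (key I hI hIB).2)

/-! ### Mutation of the weights and urban renewal -/

/-- Change of weights: at the sites `(r, s)` with `r + s ≡ n` modulo `2` the weight is inverted; at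
every other site it is multiplied by `x / (1 + x)` for each horizontal neighbour and by `1 + x` for
each vertical neighbour. -/
noncomputable def mutate (n : ℤ) (x : ℤ → ℤ → ℝ) (r s : ℤ) : ℝ :=
  if Even (r + s + n) then (x r s)⁻¹
  else x r s * ((x (r + 1) s / (1 + x (r + 1) s) * (x (r - 1) s / (1 + x (r - 1) s))) *
    ((1 + x r (s + 1)) * (1 + x r (s - 1))))

theorem mutate_pos {n : ℤ} {x : ℤ → ℤ → ℝ} (hx : ∀ r s, 0 < x r s) (r s : ℤ) :
    0 < mutate n x r s := by
  have h := hx r s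
  have h₁ := hx (r + 1) s
  have h₂ := hx (r - 1) s
  have h₃ := hx r (s + 1)
  have h₄ := hx r (s - 1)
  unfold mutate
  split_ifs <;> positivity

/-- Translation by `v` in `ℤ³`. -/
def translate (v : ℤ × ℤ × ℤ) : ℤ × ℤ × ℤ ↪ ℤ × ℤ × ℤ := addRightEmbedding v

theorem mem_map_translate {B : Finset (ℤ × ℤ × ℤ)} {a b c r s t : ℤ} :
    (r, s, t) ∈ B.map (translate (a, b, c)) ↔ (r - a, s - b, t - c) ∈ B := by
  simp only [translate, Finset.mem_map, addRightEmbedding_apply]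
  constructor
  · rintro ⟨⟨r', s', t'⟩, h, he⟩
    simp only [Prod.mk_add_mk, Prod.mk.injEq] at he
    obtain ⟨rfl, rfl, rfl⟩ := he
    simpa using h
  · intro h
    exact ⟨_, h, by simp⟩

/-- Elements of `Q_k` that cover an element of `Q_{k+1}` are its horizontal neighbours: a vertical
step of this kind is excluded by the congruences modulo `4`. -/
theorem exists_cov_iff {k r s t : ℤ} {B : Finset (ℤ × ℤ × ℤ)} (hB : B ⊆ QF k)
    (h : (r, s, t) ∈ QF (k + 1)) :
    (∃ b ∈ B, Cov (r, s, t) b) ↔ (r + 1, s, t + 1) ∈ B ∨ (r - 1, s, t + 1) ∈ B := by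
  rw [mem_QF_iff] at h
  constructor
  · rintro ⟨⟨r', s', t'⟩, hb, hc⟩
    have hb' := mem_QF_iff.1 (hB hb)
    rw [cov_iff] at hc
    obtain ⟨rfl, ⟨rfl, rfl⟩ | ⟨rfl, rfl⟩ | ⟨rfl, rfl⟩ | ⟨rfl, rfl⟩⟩ := hc
    · exact Or.inl hb
    · exact Or.inr hb
    · omega
    · omega
  · rintro (hb | hb)
    · exact ⟨_, hb, cov_iff.2 (by omega)⟩
    · exact ⟨_, hb, cov_iff.2 (by omega)⟩

/-- Elements of `Q_k` that cover an element of `Q_{k-1}` are its vertical neighbours. -/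
theorem exists_cov_iff' {k r s t : ℤ} {B : Finset (ℤ × ℤ × ℤ)} (hB : B ⊆ QF k)
    (h : (r, s, t) ∈ QF (k - 1)) :
    (∃ b ∈ B, Cov (r, s, t) b) ↔ (r, s + 1, t + 1) ∈ B ∨ (r, s - 1, t + 1) ∈ B := by
  rw [mem_QF_iff] at h
  constructor
  · rintro ⟨⟨r', s', t'⟩, hb, hc⟩
    have hb' := mem_QF_iff.1 (hB hb)
    rw [cov_iff] at hc
    obtain ⟨rfl, ⟨rfl, rfl⟩ | ⟨rfl, rfl⟩ | ⟨rfl, rfl⟩ | ⟨rfl, rfl⟩⟩ := hc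
    · omega
    · omega
    · exact Or.inl hb
    · exact Or.inr hb
  · rintro (hb | hb)
    · exact ⟨_, hb, cov_iff.2 (by omega)⟩
    · exact ⟨_, hb, cov_iff.2 (by omega)⟩

/-- Elements of `Q_k` covered by an element of `Q_{k+1}` are its vertical neighbours; either of them
may lie outside `Q_k`. -/
theorem forall_cov_iff {k r s t : ℤ} {B : Finset (ℤ × ℤ × ℤ)} (h : (r, s, t) ∈ QF (k + 1)) :
    (∀ b ∈ QF k, Cov b (r, s, t) → b ∈ B) ↔
      ((r, s + 1, t - 1) ∈ QF k → (r, s + 1, t - 1) ∈ B) ∧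
      ((r, s - 1, t - 1) ∈ QF k → (r, s - 1, t - 1) ∈ B) := by
  rw [mem_QF_iff] at h
  constructor
  · intro H
    exact ⟨fun hb => H _ hb (cov_iff.2 (by omega)), fun hb => H _ hb (cov_iff.2 (by omega))⟩
  · rintro ⟨h₁, h₂⟩ ⟨r', s', t'⟩ hb hc
    have hb' := mem_QF_iff.1 hb
    rw [cov_iff] at hc
    obtain ⟨ht, hc⟩ := hc
    have : r' = r ∧ t' = t - 1 ∧ (s' = s + 1 ∨ s' = s - 1) := by omega
    obtain ⟨rfl, rfl, rfl | rfl⟩ := this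
    · exact h₁ hb
    · exact h₂ hb

/-- Elements of `Q_k` covered by an element of `Q_{k-1}` are its horizontal neighbours, and both
always lie in `Q_k`. -/
theorem forall_cov_iff' {k r s t : ℤ} {B : Finset (ℤ × ℤ × ℤ)} (h : (r, s, t) ∈ QF (k - 1)) :
    (∀ b ∈ QF k, Cov b (r, s, t) → b ∈ B) ↔
      (r + 1, s, t - 1) ∈ B ∧ (r - 1, s, t - 1) ∈ B := by
  rw [mem_QF_iff] at h
  constructor
  · intro H
    exact ⟨H _ (mem_QF_iff.2 (by omega)) (cov_iff.2 (by omega)),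
      H _ (mem_QF_iff.2 (by omega)) (cov_iff.2 (by omega))⟩
  · rintro ⟨h₁, h₂⟩ ⟨r', s', t'⟩ hb hc
    have hb' := mem_QF_iff.1 hb
    rw [cov_iff] at hc
    obtain ⟨ht, hc⟩ := hc
    have : s' = s ∧ t' = t - 1 ∧ (r' = r + 1 ∨ r' = r - 1) := by omega
    obtain ⟨rfl, rfl, rfl | rfl⟩ := this
    · exact h₁
    · exact h₂

/-- The order induced on `Q_k` by `P_k` and the one induced by `P_{k-1}` have the same ideals. -/
theorem lowerPart_subset_upperPart_iff {k : ℤ} {B : Finset (ℤ × ℤ × ℤ)} (hB : B ⊆ QF k) :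
    lowerPart (QF (k + 1)) B ⊆ upperPart (QF (k + 1)) (QF k) B ↔
      lowerPart (QF (k - 1)) B ⊆ upperPart (QF (k - 1)) (QF k) B := by
  -- Either inclusion says that `B` is closed under the steps `(±1, ±1, -2)` inside `Q_k`; the
  -- intermediate element of such a step can be taken in `Q_{k+1}` or in `Q_{k-1}`.
  have up : lowerPart (QF (k + 1)) B ⊆ upperPart (QF (k + 1)) (QF k) B ↔
      ∀ r s t, (r, s, t) ∈ B → ∀ r' s', (r' = r + 1 ∨ r' = r - 1) → (s' = s + 1 ∨ s' = s - 1) →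
        (r', s', t - 2) ∈ QF k → (r', s', t - 2) ∈ B := by
    constructor
    · intro H r s t hb r' s' hr hs hq
      have hb' := mem_QF_iff.1 (hB hb)
      have hq' := mem_QF_iff.1 hq
      have ha : (r', s, t - 1) ∈ QF (k + 1) := mem_QF_iff.2 (by omega)
      have hl : (r', s, t - 1) ∈ lowerPart (QF (k + 1)) B :=
        mem_lowerPart.2 ⟨ha, _, hb, cov_iff.2 (by omega)⟩
      exact (mem_upperPart.1 (H hl)).2 _ hq (cov_iff.2 (by omega))
    · rintro H ⟨r, s, t⟩ ha
      obtain ⟨ha, hb⟩ := mem_lowerPart.1 ha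
      refine mem_upperPart.2 ⟨ha, ?_⟩
      rw [exists_cov_iff hB ha] at hb
      rw [forall_cov_iff ha]
      have e : t + 1 - 2 = t - 1 := by ring
      rcases hb with hb | hb
      · have := fun s' hs => H _ _ _ hb r s' (by omega) hs
        rw [e] at this
        exact ⟨this _ (Or.inl rfl), this _ (Or.inr rfl)⟩
      · have := fun s' hs => H _ _ _ hb r s' (by omega) hs
        rw [e] at this
        exact ⟨this _ (Or.inl rfl), this _ (Or.inr rfl)⟩
  rw [up]
  constructor
  · rintro H ⟨r, s, t⟩ ha
    obtain ⟨ha, hb⟩ := mem_lowerPart.1 ha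
    refine mem_upperPart.2 ⟨ha, ?_⟩
    rw [exists_cov_iff' hB ha] at hb
    rw [forall_cov_iff' ha]
    rw [mem_QF_iff] at ha
    have e : t + 1 - 2 = t - 1 := by ring
    rcases hb with hb | hb
    · have := fun r' hr hq => H _ _ _ hb r' s hr (by omega) hq
      rw [e] at this
      exact ⟨this _ (Or.inl rfl) (mem_QF_iff.2 (by omega)),
        this _ (Or.inr rfl) (mem_QF_iff.2 (by omega))⟩
    · have := fun r' hr hq => H _ _ _ hb r' s hr (by omega) hq
      rw [e] at this
      exact ⟨this _ (Or.inl rfl) (mem_QF_iff.2 (by omega)),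
        this _ (Or.inr rfl) (mem_QF_iff.2 (by omega))⟩
  · intro H r s t hb r' s' hr hs hq
    have hb' := mem_QF_iff.1 (hB hb)
    have hq' := mem_QF_iff.1 hq
    have ha : (r, s', t - 1) ∈ QF (k - 1) := mem_QF_iff.2 (by omega)
    have hl : (r, s', t - 1) ∈ lowerPart (QF (k - 1)) B :=
      mem_lowerPart.2 ⟨ha, _, hb, cov_iff.2 (by omega)⟩
    exact (mem_upperPart.1 (H hl)).2 _ hq (cov_iff.2 (by omega))

/-- Inclusion–exclusion in the horizontal direction. With `B₁` and `B₂` the two horizontal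
translates of `B` lowered by one, `lowerPart (QF (k + 1)) B = B₁ ∪ B₂`, and
`upperPart (QF (k - 1)) (QF k) B` is `B₁ ∩ B₂` raised by two. -/
theorem prod_lowerPart_mul_prod_upperPart {R : Type*} [CommMonoid R] {k : ℤ}
    {B : Finset (ℤ × ℤ × ℤ)} (hB : B ⊆ QF k) (f : ℤ → ℤ → R) :
    (∏ a ∈ lowerPart (QF (k + 1)) B, f a.1 a.2.1) *
      ∏ a ∈ upperPart (QF (k - 1)) (QF k) B, f a.1 a.2.1 =
      ∏ b ∈ B, f (b.1 + 1) b.2.1 * f (b.1 - 1) b.2.1 := by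
  have hL : lowerPart (QF (k + 1)) B =
      B.map (translate (1, 0, -1)) ∪ B.map (translate (-1, 0, -1)) := by
    ext ⟨r, s, t⟩
    simp only [Finset.mem_union, mem_map_translate, mem_lowerPart, sub_zero,
      sub_neg_eq_add]
    constructor
    · rintro ⟨ha, hb⟩
      exact ((exists_cov_iff hB ha).1 hb).symm
    · intro hb
      have ha : (r, s, t) ∈ QF (k + 1) := by
        rw [mem_QF_iff]
        rcases hb with hb | hb <;> have := mem_QF_iff.1 (hB hb) <;> omega
      exact ⟨ha, (exists_cov_iff hB ha).2 hb.symm⟩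
  have hU : upperPart (QF (k - 1)) (QF k) B =
      (B.map (translate (1, 0, -1)) ∩ B.map (translate (-1, 0, -1))).map
        (translate (0, 0, 2)) := by
    ext ⟨r, s, t⟩
    have e : t - 2 + 1 = t - 1 := by ring
    simp only [Finset.mem_inter, mem_map_translate, mem_upperPart, sub_zero,
      sub_neg_eq_add, e]
    constructor
    · rintro ⟨ha, hb⟩
      exact ((forall_cov_iff' ha).1 hb).symm
    · intro hb
      have ha : (r, s, t) ∈ QF (k - 1) := by
        rw [mem_QF_iff]
        have h₁ := mem_QF_iff.1 (hB hb.1)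
        have h₂ := mem_QF_iff.1 (hB hb.2)
        omega
      exact ⟨ha, (forall_cov_iff' ha).2 hb.symm⟩
  rw [hL, hU, Finset.prod_map (s := _ ∩ _)]
  simp only [translate, addRightEmbedding_apply, Prod.fst_add, Prod.snd_add, add_zero]
  rw [Finset.prod_union_inter, Finset.prod_map, Finset.prod_map, ← Finset.prod_mul_distrib]
  simp only [addRightEmbedding_apply, Prod.fst_add, Prod.snd_add, add_zero, ← sub_eq_add_neg]

/-- Inclusion–exclusion in the vertical direction. With `B₁` and `B₂` the two vertical
translates of `B` raised by one, `upperPart (QF (k + 1)) (QF k) B` is `B₁ ∩ B₂` and `lowerPart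
(QF (k - 1)) B` is `B₁ ∪ B₂` lowered by two, except at the bottoms of the columns. At the bottom
`t = 2|s| - k + 1` of a column with `s ≠ 0` only one of the two lower covers exists, and the
elements of `B₁ ∪ B₂` there belong to `upperPart`; at the bottom of a column with `s = 0` there
is no lower cover, which contributes the first factor on the right. -/
theorem prod_upperPart_mul_prod_lowerPart {R : Type*} [CommMonoid R] {k : ℕ}
    {B : Finset (ℤ × ℤ × ℤ)} (hB : B ⊆ QF k) (g : ℤ → ℤ → R) :
    (∏ a ∈ upperPart (QF (k + 1)) (QF k) B, g a.1 a.2.1) *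
      ∏ a ∈ lowerPart (QF (k - 1)) B, g a.1 a.2.1 =
      (∏ i ∈ Finset.range k, g (2 * i - k + 1) 0) *
        ∏ b ∈ B, g b.1 (b.2.1 + 1) * g b.1 (b.2.1 - 1) := by
  classical
  set B₁ := B.map (translate (0, 1, 1)) with hB₁
  set B₂ := B.map (translate (0, -1, 1)) with hB₂
  have mem₁ {r s t : ℤ} : (r, s, t) ∈ B₁ ↔ (r, s - 1, t - 1) ∈ B := by
    rw [hB₁, mem_map_translate, sub_zero]
  have mem₂ {r s t : ℤ} : (r, s, t) ∈ B₂ ↔ (r, s + 1, t - 1) ∈ B := by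
    rw [hB₂, mem_map_translate, sub_zero, sub_neg_eq_add]
  -- The bottoms of the columns of `Q_{k+1}`.
  let bot : ℤ × ℤ × ℤ → Prop := fun a => a.2.2 = 2 * |a.2.1| - k + 1
  have hbot {r s t : ℤ} : bot (r, s, t) ↔
      t + k - 1 = 2 * s ∧ 0 ≤ s ∨ t + k - 1 = - 2 * s ∧ s < 0 := by
    change t = 2 * |s| - k + 1 ↔ _
    rcases abs_cases s with ⟨h, _⟩ | ⟨h, _⟩ <;> rw [h] <;> omega
  let C : Finset (ℤ × ℤ × ℤ) := {a ∈ QF (k + 1) | a.2.1 = 0 ∧ bot a}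
  have hU : upperPart (QF (k + 1)) (QF k) B =
      (B₁ ∩ B₂ ∪ {a ∈ B₁ ∪ B₂ | bot a}) ∪ C := by
    ext ⟨r, s, t⟩
    simp only [C, mem_upperPart, Finset.mem_filter, Finset.mem_union, Finset.mem_inter, mem₁, mem₂,
      hbot]
    constructor
    · rintro ⟨ha, hb⟩
      rw [forall_cov_iff ha] at hb
      by_cases h₁ : (r, s + 1, t - 1) ∈ QF k <;> by_cases h₂ : (r, s - 1, t - 1) ∈ QF k
      · exact Or.inl (Or.inl ⟨hb.2 h₂, hb.1 h₁⟩)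
      · refine Or.inl (Or.inr ⟨Or.inr (hb.1 h₁), ?_⟩)
        rw [mem_QF_iff] at *
        omega
      · refine Or.inl (Or.inr ⟨Or.inl (hb.2 h₂), ?_⟩)
        rw [mem_QF_iff] at *
        omega
      · refine Or.inr ⟨ha, ?_⟩
        rw [mem_QF_iff] at *
        omega
    · rintro ((⟨h₁, h₂⟩ | ⟨h₁ | h₂, h₃⟩) | ⟨ha, h⟩)
      · have h₁' := mem_QF_iff.1 (hB h₁)
        have h₂' := mem_QF_iff.1 (hB h₂)
        have ha : (r, s, t) ∈ QF (k + 1) := mem_QF_iff.2 (by omega)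
        exact ⟨ha, (forall_cov_iff ha).2 ⟨fun _ => h₂, fun _ => h₁⟩⟩
      · have h₁' := mem_QF_iff.1 (hB h₁)
        have ha : (r, s, t) ∈ QF (k + 1) := mem_QF_iff.2 (by omega)
        refine ⟨ha, (forall_cov_iff ha).2 ⟨fun h => ?_, fun _ => h₁⟩⟩
        rw [mem_QF_iff] at h
        omega
      · have h₂' := mem_QF_iff.1 (hB h₂)
        have ha : (r, s, t) ∈ QF (k + 1) := mem_QF_iff.2 (by omega)
        refine ⟨ha, (forall_cov_iff ha).2 ⟨fun _ => h₂, fun h => ?_⟩⟩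
        rw [mem_QF_iff] at h
        omega
      · refine ⟨ha, (forall_cov_iff ha).2 ⟨fun h => ?_, fun h => ?_⟩⟩ <;>
          · rw [mem_QF_iff] at h
            omega
  have hL : (lowerPart (QF (k - 1)) B).map (translate (0, 0, 2)) =
      {a ∈ B₁ ∪ B₂ | ¬ bot a} := by
    ext ⟨r, s, t⟩
    have e : t - 2 + 1 = t - 1 := by ring
    simp only [mem_lowerPart, mem_map_translate, Finset.mem_filter, Finset.mem_union, mem₁, mem₂,
      hbot, sub_zero]
    constructor
    · rintro ⟨ha, hb⟩
      rw [exists_cov_iff' hB ha, e] at hb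
      refine ⟨hb.symm, ?_⟩
      rw [mem_QF_iff] at ha
      omega
    · rintro ⟨hb, h⟩
      have ha : (r, s, t - 2) ∈ QF (k - 1) := by
        rw [mem_QF_iff]
        rcases hb with hb | hb <;> have := mem_QF_iff.1 (hB hb) <;> omega
      rw [exists_cov_iff' hB ha, e]
      exact ⟨ha, hb.symm⟩
  have hdis₁ : Disjoint (B₁ ∩ B₂ ∪ {a ∈ B₁ ∪ B₂ | bot a}) C := by
    rw [Finset.disjoint_left]
    rintro ⟨r, s, t⟩ h hC
    simp only [C, Finset.mem_filter, Finset.mem_union, Finset.mem_inter, mem₁, mem₂, hbot] at h hC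
    rcases h with ⟨h, -⟩ | ⟨h | h, -⟩ <;> have := mem_QF_iff.1 (hB h) <;> omega
  have hdis₂ : Disjoint (B₁ ∩ B₂) {a ∈ B₁ ∪ B₂ | bot a} := by
    rw [Finset.disjoint_left]
    rintro ⟨r, s, t⟩ h h'
    simp only [Finset.mem_filter, Finset.mem_inter, mem₁, mem₂, hbot] at h h'
    have := mem_QF_iff.1 (hB h.1)
    have := mem_QF_iff.1 (hB h.2)
    omega
  have hC : ∏ a ∈ C, g a.1 a.2.1 = ∏ i ∈ Finset.range k, g (2 * i - k + 1) 0 := by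
    symm
    refine Finset.prod_bij (fun i _ => ((2 * i - k + 1 : ℤ), (0 : ℤ), (-k + 1 : ℤ)))
      ?_ ?_ ?_ ?_
    · intro i hi
      rw [Finset.mem_range] at hi
      simp only [C, Finset.mem_filter, hbot]
      rw [mem_QF_iff]
      exact ⟨by omega, trivial, by omega⟩
    · intro i _ i' _ h
      simp only [Prod.mk.injEq] at h
      omega
    · rintro ⟨r, s, t⟩ h
      simp only [C, Finset.mem_filter, hbot] at h
      rw [mem_QF_iff] at h
      refine ⟨((r + k - 1) / 2).toNat, Finset.mem_range.2 (by omega), ?_⟩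
      simp only [Prod.mk.injEq]
      omega
    · intro i _
      rfl
  have hL' : ∏ a ∈ lowerPart (QF (k - 1)) B, g a.1 a.2.1 =
      ∏ a ∈ B₁ ∪ B₂ with ¬ bot a, g a.1 a.2.1 := by
    rw [← hL, Finset.prod_map]
    simp only [translate, addRightEmbedding_apply, Prod.fst_add, Prod.snd_add, add_zero]
  have hBB : (∏ a ∈ B₁ ∪ B₂, g a.1 a.2.1) * ∏ a ∈ B₁ ∩ B₂, g a.1 a.2.1 =
      ∏ b ∈ B, g b.1 (b.2.1 + 1) * g b.1 (b.2.1 - 1) := by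
    rw [Finset.prod_union_inter, hB₁, hB₂, Finset.prod_map, Finset.prod_map,
      ← Finset.prod_mul_distrib]
    simp only [translate, addRightEmbedding_apply, Prod.fst_add, Prod.snd_add, add_zero,
      ← sub_eq_add_neg]
  rw [hU, Finset.prod_union hdis₁, Finset.prod_union hdis₂, hL', hC, ← hBB,
    ← Finset.prod_filter_mul_prod_filter_not (B₁ ∪ B₂) bot]
  ac_rfl

theorem disjoint_QF (k : ℤ) : Disjoint (QF (k + 1)) (QF k) := by
  rw [Finset.disjoint_left]
  rintro ⟨r, s, t⟩ h h'
  rw [mem_QF_iff] at h h'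
  omega

theorem not_cov_of_mem_QF (k : ℤ) : ∀ a ∈ QF k, ∀ b ∈ QF k, ¬ Cov a b := by
  rintro ⟨r, s, t⟩ h ⟨r', s', t'⟩ h' hc
  rw [mem_QF_iff] at h h'
  rw [cov_iff] at hc
  omega

/-- Urban renewal: summing out the layer `Q_{k+1}` of `P_k` gives, up to the contribution of the
minimal elements of `P_k`, the same as summing out the layer `Q_{k-1}` of `P_{k-1}` with the
mutated weights. -/
theorem G_eq_mul_G_mutate {x : ℤ → ℤ → ℝ} (hx : ∀ r s, 0 < x r s) (k : ℕ) :
    G k x = (∏ i ∈ Finset.range k, (1 + x (2 * i - k + 1) 0)) * G (k - 1) (mutate (k + 1) x) := by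
  have hdis : Disjoint (QF ((k : ℤ) - 1)) (QF k) := by
    simpa using (disjoint_QF ((k : ℤ) - 1)).symm
  unfold G
  rw [sub_add_cancel, Finset.union_comm (QF (k : ℤ)) (QF ((k : ℤ) - 1)),
    sum_ideals_union (disjoint_QF k) (not_cov_of_mem_QF _) (not_cov_of_mem_QF _)
      (fun p => x p.1 p.2.1),
    sum_ideals_union hdis (not_cov_of_mem_QF _) (not_cov_of_mem_QF _)
      (fun p => mutate (k + 1) x p.1 p.2.1), Finset.mul_sum]
  refine Finset.sum_congr rfl fun B hB => ?_
  rw [Finset.mem_powerset] at hB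
  simp only [← lowerPart_subset_upperPart_iff hB]
  split_ifs with hLU
  swap
  · rw [mul_zero]
  have hLU' := (lowerPart_subset_upperPart_iff hB).1 hLU
  have hx0 : ∀ r s, x r s ≠ 0 := fun r s => (hx r s).ne'
  have hx1 : ∀ r s, 1 + x r s ≠ 0 := fun r s => by
    have := hx r s
    positivity
  -- The sum over the sets between `L` and `U` as a product over `L` times a product over `U`.
  have hsplit : ∀ (L U : Finset (ℤ × ℤ × ℤ)) (w : ℤ × ℤ × ℤ → ℝ), (∀ a ∈ U, 1 + w a ≠ 0) →
      L ⊆ U → (∏ a ∈ L, w a) * ∏ a ∈ U \ L, (1 + w a) =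
        (∏ a ∈ L, w a / (1 + w a)) * ∏ a ∈ U, (1 + w a) := by
    intro L U w hw h
    rw [← Finset.prod_sdiff h, Finset.prod_div_distrib]
    have : ∏ a ∈ L, (1 + w a) ≠ 0 := Finset.prod_ne_zero_iff.2 fun a ha => hw a (h ha)
    field_simp
  rw [hsplit _ _ _ (fun a _ => hx1 _ _) hLU,
    hsplit _ _ _ (fun a _ => by have := mutate_pos (n := k + 1) hx a.1 a.2.1; positivity) hLU']
  -- The weights of `Q_k` are multiplied by a factor, those of `Q_{k-1}` are inverted.
  have hmB : ∏ b ∈ B, mutate (k + 1) x b.1 b.2.1 = (∏ b ∈ B, x b.1 b.2.1) *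
      ((∏ b ∈ B, x (b.1 + 1) b.2.1 / (1 + x (b.1 + 1) b.2.1) *
        (x (b.1 - 1) b.2.1 / (1 + x (b.1 - 1) b.2.1))) *
      ∏ b ∈ B, (1 + x b.1 (b.2.1 + 1)) * (1 + x b.1 (b.2.1 - 1))) := by
    rw [← Finset.prod_mul_distrib, ← Finset.prod_mul_distrib]
    refine Finset.prod_congr rfl ?_
    rintro ⟨r, s, t⟩ hb
    have hb := mem_QF_iff.1 (hB hb)
    rw [mutate, if_neg]
    rw [Int.even_iff]
    dsimp only
    omega
  have hmC : ∀ a ∈ QF ((k : ℤ) - 1), mutate (k + 1) x a.1 a.2.1 = (x a.1 a.2.1)⁻¹ := by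
    rintro ⟨r, s, t⟩ ha
    rw [mem_QF_iff] at ha
    rw [mutate, if_pos]
    rw [Int.even_iff]
    dsimp only
    omega
  have hmL : ∏ a ∈ lowerPart (QF ((k : ℤ) - 1)) B,
      mutate (k + 1) x a.1 a.2.1 / (1 + mutate (k + 1) x a.1 a.2.1) =
      (∏ a ∈ lowerPart (QF ((k : ℤ) - 1)) B, (1 + x a.1 a.2.1))⁻¹ := by
    rw [← Finset.prod_inv_distrib]
    refine Finset.prod_congr rfl fun a ha => ?_
    rw [hmC a (mem_lowerPart.1 ha).1]
    have h₀ := hx0 a.1 a.2.1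
    have h₁ := hx1 a.1 a.2.1
    have h₂ : x a.1 a.2.1 + 1 ≠ 0 := by rwa [add_comm]
    field_simp
    ring
  have hmU : ∏ a ∈ upperPart (QF ((k : ℤ) - 1)) (QF k) B, (1 + mutate (k + 1) x a.1 a.2.1) =
      (∏ a ∈ upperPart (QF ((k : ℤ) - 1)) (QF k) B, x a.1 a.2.1 / (1 + x a.1 a.2.1))⁻¹ := by
    rw [← Finset.prod_inv_distrib]
    refine Finset.prod_congr rfl fun a ha => ?_
    rw [hmC a (mem_upperPart.1 ha).1]
    have h₀ := hx0 a.1 a.2.1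
    have h₁ := hx1 a.1 a.2.1
    field_simp
    ring
  have h₁ := prod_lowerPart_mul_prod_upperPart hB (fun r s => x r s / (1 + x r s))
  have h₂ := prod_upperPart_mul_prod_lowerPart hB (fun r s => 1 + x r s)
  have hU0 : ∏ a ∈ upperPart (QF ((k : ℤ) - 1)) (QF k) B, x a.1 a.2.1 / (1 + x a.1 a.2.1) ≠ 0 :=
    Finset.prod_ne_zero_iff.2 fun a _ => div_ne_zero (hx0 _ _) (hx1 _ _)
  have hL0 : ∏ a ∈ lowerPart (QF ((k : ℤ) - 1)) B, (1 + x a.1 a.2.1) ≠ 0 :=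
    Finset.prod_ne_zero_iff.2 fun a _ => hx1 _ _
  rw [hmB, hmL, hmU, ← h₁]
  rw [show ∀ c p q r s t : ℝ, c * (p * (q * r) * (s * t)) = p * q * (c * r) * (s * t) by
    intros; ring, ← h₂]
  field_simp

/-! ### The octahedron recurrence -/

/-- The weights seen from the site `(a, b)`. -/
def shift {R : Type*} (a b : ℤ) (x : ℤ → ℤ → R) (r s : ℤ) : R := x (r + a) (s + b)

theorem mutate_shift (n a b : ℤ) (x : ℤ → ℤ → ℝ) :
    mutate n (shift a b x) = shift a b (mutate (n - a - b) x) := by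
  funext r s
  have h : Even (r + s + n) ↔ Even (r + a + (s + b) + (n - a - b)) := by
    rw [show r + a + (s + b) + (n - a - b) = r + s + n by ring]
  simp only [mutate, shift, h, add_right_comm _ (1 : ℤ), add_sub_right_comm]

theorem mutate_add_two (n : ℤ) (x : ℤ → ℤ → ℝ) : mutate (n + 2) x = mutate n x := by
  funext r s
  have h : Even (r + s + (n + 2)) ↔ Even (r + s + n) := by
    simp only [Int.even_iff]
    omega
  simp only [mutate, h]

/-- An interval symmetric about `0` splits into two progressions of step `2`. -/
theorem prod_Icc_neg_eq {R : Type*} [CommMonoid R] (h : ℤ → R) (k : ℕ) :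
    ∏ i ∈ Finset.Icc (-(k : ℤ)) k, h i =
      (∏ i ∈ Finset.range (k + 1), h (2 * i - k)) * ∏ i ∈ Finset.range k, h (2 * i - k + 1) := by
  induction k with
  | zero => simp
  | succ k ih =>
    have hIcc : Finset.Icc (-((k + 1 : ℕ) : ℤ)) ((k + 1 : ℕ) : ℤ) =
        insert (-(k : ℤ) - 1) (insert ((k : ℤ) + 1) (Finset.Icc (-(k : ℤ)) k)) := by
      ext i
      simp only [Finset.mem_Icc, Finset.mem_insert]
      omega
    rw [hIcc, Finset.prod_insert (by simp; omega), Finset.prod_insert (by simp), ih,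
      Finset.prod_range_succ' _ (k + 1)]
    have e₁ : ∀ i : ℕ, 2 * ((i + 1 : ℕ) : ℤ) - ((k + 1 : ℕ) : ℤ) = 2 * i - k + 1 := by
      intro i
      push_cast
      ring
    have e₂ : ∀ i : ℕ, 2 * (i : ℤ) - ((k + 1 : ℕ) : ℤ) + 1 = 2 * i - k := by
      intro i
      push_cast
      ring
    have e₃ : 2 * ((0 : ℕ) : ℤ) - ((k + 1 : ℕ) : ℤ) = -(k : ℤ) - 1 := by
      push_cast
      ring
    have e₄ : 2 * (k : ℤ) - k + 1 = k + 1 := by ring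
    simp only [e₁, e₂, e₃]
    rw [Finset.prod_range_succ (fun i : ℕ => h (2 * i - k + 1)) k, e₄]
    ac_rfl

/-- For `k ≤ 0` the poset `P_k` is empty. -/
theorem G_of_nonpos {R : Type*} [CommSemiring R] {k : ℤ} (hk : k ≤ 0) (x : ℤ → ℤ → R) :
    G k x = 1 := by
  have h : QF (k + 1) ∪ QF k = ∅ := by
    ext ⟨r, s, t⟩
    simp only [Finset.mem_union, mem_QF_iff, Finset.notMem_empty, iff_false]
    omega
  simp [G, h, ideals]

theorem G_one {x : ℤ → ℤ → ℝ} (hx : ∀ r s, 0 < x r s) : G 1 x = 1 + x 0 0 := by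
  simpa [G_of_nonpos] using G_eq_mul_G_mutate hx 1

/-- Cancellation along a row in the mutation of the recurrence's coefficient; `u i` are the weights
on the row and `v i` stands for `1 + u i`. -/
theorem prod_row_mutate {u v : ℕ → ℝ} (hu : ∀ i, u i ≠ 0) (hv : ∀ i, v i ≠ 0) (k : ℕ) :
    ((∏ i ∈ Finset.range (k + 2), v i) * ∏ i ∈ Finset.range k, v (i + 1)) *
      ((∏ i ∈ Finset.range (k + 1), u (i + 1) / v (i + 1) * (u i / v i)) *
        ∏ i ∈ Finset.range k, (u (i + 1))⁻¹) = ∏ i ∈ Finset.range (k + 2), u i := by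
  rw [Finset.prod_mul_distrib, Finset.prod_div_distrib, Finset.prod_div_distrib,
    Finset.prod_inv_distrib, Finset.prod_range_succ' v (k + 1), Finset.prod_range_succ' u (k + 1),
    Finset.prod_range_succ' v k, Finset.prod_range_succ' u k]
  have hu' : ∏ i ∈ Finset.range k, u (i + 1) ≠ 0 := Finset.prod_ne_zero_iff.2 fun _ _ => hu _
  have hv' : ∏ i ∈ Finset.range k, v (i + 1) ≠ 0 := Finset.prod_ne_zero_iff.2 fun _ _ => hv _
  have hv'' : ∏ i ∈ Finset.range (k + 1), v (i + 1) ≠ 0 :=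
    Finset.prod_ne_zero_iff.2 fun _ _ => hv _
  have hv0 := hv 0
  field_simp

/-- The octahedron recurrence for the generating functions `G`, at positive weights. Mutating the
weights lowers each index by one, so the relation for `k + 1` is the relation for `k` at the mutated
weights, once the factors from `G_eq_mul_G_mutate` are matched. -/
theorem G_recurrence_of_pos (k : ℕ) : ∀ {x : ℤ → ℤ → ℝ}, (∀ r s, 0 < x r s) →
    G (k + 1) x * G (k - 1) x = G k (shift (-1) 0 x) * G k (shift 1 0 x) +
      (∏ i ∈ Finset.Icc (-(k : ℤ)) k, x i 0) * (G k (shift 0 (-1) x) * G k (shift 0 1 x)) := by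
  induction k with
  | zero =>
    intro x hx
    simp [G_of_nonpos, G_one hx]
  | succ k ih =>
    intro x hx
    set x' := mutate (k + 1) x with hx'
    have hx'pos : ∀ r s, 0 < x' r s := mutate_pos hx
    have hsh : ∀ (a b : ℤ), ∀ r s, 0 < shift a b x r s := fun a b r s => hx _ _
    have IH := ih hx'pos
    have hG₂ := G_eq_mul_G_mutate hx (k + 2)
    have hG₀ := G_eq_mul_G_mutate hx k
    have hG₁ : ∀ a b : ℤ, a + b = 1 ∨ a + b = -1 → G ((k : ℤ) + 1) (shift a b x) =
        (∏ i ∈ Finset.range (k + 1), (1 + x (2 * i - k + a) b)) * G k (shift a b x') := by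
      intro a b hab
      have h := G_eq_mul_G_mutate (hsh a b) (k + 1)
      have hm : mutate ((k + 1 : ℕ) + 1) (shift a b x) = shift a b x' := by
        rw [mutate_shift, hx']
        rcases hab with hab | hab
        · congr 2
          push_cast
          linarith
        · rw [← mutate_add_two ((k : ℤ) + 1)]
          congr 2
          push_cast
          linarith
      rw [hm] at h
      push_cast at h
      rw [h, add_sub_cancel_right]
      congr 1
      refine Finset.prod_congr rfl fun i _ => ?_
      simp only [shift]
      congr 2 <;> ring
    have hG₁₀ := hG₁ 1 0 (by norm_num)
    have hG₁₀' := hG₁ (-1) 0 (by norm_num)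
    have hG₀₁ := hG₁ 0 1 (by norm_num)
    have hG₀₁' := hG₁ 0 (-1) (by norm_num)
    -- The weights in the central row with the parity of the outer layer, indexed from the left.
    set u : ℕ → ℝ := fun i => x (2 * i - k - 1) 0 with hu
    set v : ℕ → ℝ := fun i => 1 + u i with hv
    have hu0 : ∀ i, u i ≠ 0 := fun i => (hx _ _).ne'
    have hv0 : ∀ i, v i ≠ 0 := fun i => (add_pos one_pos (hx _ _)).ne'
    have hus : ∀ i : ℕ, x (2 * i - k + 1) 0 = u (i + 1) := by
      intro i
      simp only [hu]
      congr 1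
      push_cast
      ring
    have hG₂' : G ((k : ℤ) + 1 + 1) x = (∏ i ∈ Finset.range (k + 2), v i) * G (k + 1) x' := by
      have e₁ : ((k + 2 : ℕ) : ℤ) = k + 1 + 1 := by push_cast; ring
      have e₂ : ∀ i : ℕ, 2 * (i : ℤ) - (k + 1 + 1) + 1 = 2 * i - k - 1 := fun i => by ring
      have e₃ : (k : ℤ) + 1 + 1 + 1 = k + 1 + 2 := by ring
      rw [e₁, add_sub_cancel_right, e₃, mutate_add_two] at hG₂
      simpa only [e₂] using hG₂
    simp only [hus] at hG₀ hG₁₀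
    simp only [← sub_eq_add_neg] at hG₁₀'
    simp only [add_zero] at hG₀₁ hG₀₁'
    have hc : (∏ i ∈ Finset.range (k + 2), v i) * ∏ i ∈ Finset.range k, v (i + 1) =
        (∏ i ∈ Finset.range (k + 1), v i) * ∏ i ∈ Finset.range (k + 1), v (i + 1) := by
      rw [Finset.prod_range_succ v (k + 1), Finset.prod_range_succ (fun i => v (i + 1)) k]
      ring
    have hrow := prod_Icc_neg_eq (fun i => x i 0) (k + 1)
    have hrow' := prod_Icc_neg_eq (fun i => x' i 0) k
    have hx'₁ : ∀ i : ℕ, x' (2 * i - k) 0 = x (2 * i - k) 0 *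
        ((u (i + 1) / v (i + 1) * (u i / v i)) *
          ((1 + x (2 * i - k) 1) * (1 + x (2 * i - k) (-1)))) := by
      intro i
      rw [hx', mutate, if_neg (by rw [Int.even_iff]; omega), hus]
      simp only [zero_add, zero_sub, hv, hu]
    have hx'₂ : ∀ i : ℕ, x' (2 * i - k + 1) 0 = (u (i + 1))⁻¹ := by
      intro i
      rw [hx', mutate, if_pos (by rw [Int.even_iff]; omega), hus]
    simp only [hx'₁, hx'₂] at hrow'
    have e₁ : ∀ i : ℕ, 2 * (i : ℤ) - ((k + 1 : ℕ) : ℤ) = 2 * i - k - 1 := fun i => by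
      push_cast
      ring
    simp only [e₁, sub_add_cancel] at hrow
    have hcancel := prod_row_mutate hu0 hv0 k
    have hcoef : ((∏ i ∈ Finset.range (k + 2), v i) * ∏ i ∈ Finset.range k, v (i + 1)) *
        ∏ i ∈ Finset.Icc (-(k : ℤ)) k, x' i 0 =
        (∏ i ∈ Finset.Icc (-((k + 1 : ℕ) : ℤ)) ((k + 1 : ℕ) : ℤ), x i 0) *
          ((∏ i ∈ Finset.range (k + 1), (1 + x (2 * i - k) (-1))) *
            ∏ i ∈ Finset.range (k + 1), (1 + x (2 * i - k) 1)) := by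
      rw [hrow, hrow', Finset.prod_mul_distrib, Finset.prod_mul_distrib,
        Finset.prod_mul_distrib (f := fun i : ℕ => 1 + x (2 * i - k) 1), ← hcancel]
      ring
    have e₂ : ((k + 1 : ℕ) : ℤ) = k + 1 := by push_cast; ring
    rw [e₂, add_sub_cancel_right, hG₂', hG₀, hG₁₀, hG₁₀', hG₀₁, hG₀₁', ← e₂]
    calc _ = ((∏ i ∈ Finset.range (k + 2), v i) * ∏ i ∈ Finset.range k, v (i + 1)) *
          (G (k + 1) x' * G (k - 1) x') := by
            push_cast
            ring
      _ = _ := by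
        rw [IH, mul_add, ← mul_assoc _ (∏ i ∈ Finset.Icc (-(k : ℤ)) k, x' i 0), hcoef, hc]
        ring

/-! ### Polynomials and the rational functions `F` -/

theorem map_G {R S : Type*} [CommSemiring R] [CommSemiring S] (φ : R →+* S) (k : ℤ)
    (x : ℤ → ℤ → R) : φ (G k x) = G k (fun r s => φ (x r s)) := by
  simp only [G, map_sum, map_prod]

theorem G_pos (k : ℤ) {x : ℤ → ℤ → ℝ} (hx : ∀ r s, 0 < x r s) : 0 < G k x := by
  refine Finset.sum_pos (fun I _ => Finset.prod_pos fun p _ => hx _ _) ⟨∅, ?_⟩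
  simp [ideals]

/-- The generating function `∑_{I ∈ J(P_k)} ∏_{(r, s, t) ∈ I} y_{3r+s+j}`. -/
noncomputable def idealPoly (m : ℕ) (j k : ℤ) : MvPolynomial (ZMod m) ℤ :=
  G k fun r s => y m (3 * r + s + j)

/-- Evaluation of integer polynomials at a real point. -/
noncomputable def evalReal {m : ℕ} (v : ZMod m → ℝ) : MvPolynomial (ZMod m) ℤ →+* ℝ :=
  MvPolynomial.eval₂Hom (Int.castRingHom ℝ) v

theorem evalReal_y {m : ℕ} (v : ZMod m → ℝ) (j : ℤ) : evalReal v (y m j) = v j := by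
  simp [evalReal, y]

theorem evalReal_idealPoly {m : ℕ} (v : ZMod m → ℝ) (j k : ℤ) :
    evalReal v (idealPoly m j k) = G k fun r s => v ((3 * r + s + j : ℤ) : ZMod m) := by
  simp only [idealPoly, map_G, evalReal_y]

/-- Integer polynomials that agree at all points with positive real coordinates are equal. -/
theorem eq_of_evalReal_eq {m : ℕ} {p q : MvPolynomial (ZMod m) ℤ}
    (h : ∀ v : ZMod m → ℝ, (∀ i, 0 < v i) → evalReal v p = evalReal v q) : p = q := by
  apply MvPolynomial.map_injective (Int.castRingHom ℝ) Int.cast_injective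
  refine MvPolynomial.funext_set (fun _ => Set.Ioi 0) (fun _ => Set.Ioi_infinite 0) fun v hv => ?_
  have := h v fun i => hv i (Set.mem_univ i)
  simpa only [evalReal, MvPolynomial.coe_eval₂Hom, ← MvPolynomial.eval_map] using this

theorem idealPoly_ne_zero (m : ℕ) (j k : ℤ) : idealPoly m j k ≠ 0 := by
  intro h
  have h₁ := evalReal_idealPoly (fun _ : ZMod m => (1 : ℝ)) j k
  rw [h, map_zero] at h₁
  exact (G_pos k fun _ _ => one_pos).ne h₁

theorem idealPoly_of_nonpos (m : ℕ) (j : ℤ) {k : ℤ} (hk : k ≤ 0) : idealPoly m j k = 1 :=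
  G_of_nonpos hk _

theorem idealPoly_recurrence (m : ℕ) (j : ℤ) (k : ℕ) :
    idealPoly m j (k + 1) * idealPoly m j (k - 1) =
      idealPoly m (j - 3) k * idealPoly m (j + 3) k +
        (∏ i ∈ Finset.Icc (-(k : ℤ)) k, y m (j + 3 * i)) *
          (idealPoly m (j - 1) k * idealPoly m (j + 1) k) := by
  refine eq_of_evalReal_eq fun v hv => ?_
  have h := G_recurrence_of_pos k (x := fun r s => v ((3 * r + s + j : ℤ) : ZMod m))
    fun _ _ => hv _
  have hs : ∀ a b : ℤ, shift a b (fun r s => v ((3 * r + s + j : ℤ) : ZMod m)) =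
      fun r s => v ((3 * r + s + (j + (3 * a + b)) : ℤ) : ZMod m) := by
    intro a b
    funext r s
    simp only [shift]
    congr 2
    ring
  have hp : ∀ i : ℤ, 3 * i + 0 + j = j + 3 * i := fun i => by ring
  have e₁ : j + (3 * (-1) + 0) = j - 3 := by ring
  have e₂ : j + (3 * 1 + 0) = j + 3 := by ring
  have e₃ : j + (3 * 0 + -1) = j - 1 := by ring
  have e₄ : j + (3 * 0 + 1) = j + 1 := by ring
  simp only [hs, hp] at h
  simp only [map_add, map_mul, map_prod, evalReal_y, evalReal_idealPoly]
  simpa only [e₁, e₂, e₃, e₄] using h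

/-- Two consecutive values are proved together, since the recurrence has depth two; the division in
it is by a nonzero element. -/
theorem FAux_eq (m : ℕ) (n : ℕ) :
    (∀ j, FAux m n j = algebraMap _ (RatFun m) (idealPoly m j (n - 1))) ∧
      ∀ j, FAux m (n + 1) j = algebraMap _ (RatFun m) (idealPoly m j n) := by
  induction n with
  | zero =>
    constructor <;> intro j <;> rw [FAux, idealPoly_of_nonpos _ _ (by simp), map_one]
  | succ k ih =>
    have e : ((k + 1 : ℕ) : ℤ) - 1 = k := by push_cast; ring
    refine ⟨fun j => by rw [ih.2, e], fun j => ?_⟩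
    have h0 : algebraMap _ (RatFun m) (idealPoly m j (k - 1)) ≠ 0 := fun h =>
      idealPoly_ne_zero m j (k - 1) ((IsFractionRing.injective _ (RatFun m)) (by rw [h, map_zero]))
    rw [FAux, ih.1, ih.2, ih.2, ih.2, ih.2, div_eq_iff h0, Nat.cast_succ,
      ← map_mul _ (idealPoly m j (k + 1)), idealPoly_recurrence]
    simp only [map_add, map_mul, map_prod]

theorem F_eq (m : ℕ) (j k : ℤ) (hk : -1 ≤ k) :
    F m j k = algebraMap _ (RatFun m) (idealPoly m j k) := by
  rw [F, (FAux_eq m _).1, Int.toNat_of_nonneg (by omega), add_sub_cancel_right]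

theorem coeff_weight_nonneg (m : ℕ) (j : ℤ) {k : ℤ} (I : Set (P k)) (d : ZMod m →₀ ℕ) :
    0 ≤ (weight m j I).coeff d := by
  classical
  -- A product of variables is a monomial with coefficient `1`.
  have h : weight m j I = MvPolynomial.monomial
      (∑ p : P k with p ∈ I, Finsupp.single ((3 * p.r + p.s + j : ℤ) : ZMod m) 1) 1 := by
    rw [MvPolynomial.monomial_sum_one]
    simp only [weight, y, MvPolynomial.X]
  rw [h, MvPolynomial.coeff_monomial]
  split_ifs <;> norm_num

end Pentagram

theorem mainTheorem2 (m : ℕ) (j k : ℤ) (hk : -1 ≤ k) :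
    Pentagram.F m j k ≠ 0 ∧
    ∃ p : MvPolynomial (ZMod m) ℤ,
      algebraMap (MvPolynomial (ZMod m) ℤ) (Pentagram.RatFun m) p = Pentagram.F m j k ∧
      p = ∑ I : Pentagram.J k, Pentagram.weight m j (I : Set (Pentagram.P k)) ∧
      ∀ d ∈ p.support, 0 < p.coeff d := by
  have hF := Pentagram.F_eq m j k hk
  refine ⟨?_, Pentagram.idealPoly m j k, hF.symm, (Pentagram.sum_weight_eq_G m j k).symm, ?_⟩
  · rw [hF]
    exact fun h => Pentagram.idealPoly_ne_zero m j k
      ((IsFractionRing.injective _ (Pentagram.RatFun m)) (by rw [h, map_zero]))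
  · intro d hd
    refine lt_of_le_of_ne ?_ (MvPolynomial.mem_support_iff.1 hd).symm
    rw [Pentagram.idealPoly, ← Pentagram.sum_weight_eq_G, MvPolynomial.coeff_sum]
    exact Finset.sum_nonneg fun I _ => Pentagram.coeff_weight_nonneg m j _ d
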